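/- All graphs are finite and simple, and $\alpha(G)$ denotes the independence number of $G$. For integers $k>\ell\ge 0$, a graph $G$ on $n$ vertices is called $(k,\ell)$-stable if deleting any $k$ vertices from $G$ leaves an induced subgraph with independence number at least $\alpha(G)-\ell$. It is called tight $(k,\ell)$-stable if, in addition, $\alpha(G)=\left\lfloor\frac{n-k+1}{2}\right\rfloor+\ell$. An even subdivision of $K_4$ is a graph obtained from $K_4$ by finitely many (possibly zero) operations, each of which replaces an edge $uv$ of the current graph by a path $u\,u'\,v'\,v$ through two new vertices $u',v'$. An odd cycle is a cycle graph $C_m$ with $m\ge 3$ odd. Theorem. Let $G$ be a tight $(k,0)$-stable graph on $n$ vertices. (a) If $k=1$ and $n$ is even, then $G$ contains a perfect matching. (b) If $k=1$ and $n$ is odd, then $G$ has a spanning subgraph that is a vertex-disjoint union of an odd cycle and a (possibly empty) matching. (c) If $k=2$ and $n$ is odd, then $n\ge 3$ and $G$ is (isomorphic to) the odd cycle $C_n$. (d) If $k=2$ and $n$ is even, then $G$ has a spanning subgraph that is either a vertex-disjoint union of two odd cycles, or an even subdivision of $K_4$. -/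

import Mathlib

universe u v

namespace SimpleGraph

/-- `G` is `(k, l)`-stable: removing any `k` vertices lowers the independence number by at
most `l`. -/
def IsKLStable {V : Type u} (G : SimpleGraph V) (k l : ℕ) : Prop :=
  ∀ s : Finset V, s.card = k → G.indepNum ≤ (G.induce ((s : Set V)ᶜ)).indepNum + l

/-- `G` is tight `(k, l)`-stable: it is `(k, l)`-stable and its independence number equals
`⌊(n - k + 1) / 2⌋ + l`, where `n` is the number of vertices. The floor is that of integers, so
there is no truncated subtraction. -/
def IsTightStable {V : Type u} [Fintype V] (G : SimpleGraph V) (k l : ℕ) : Prop :=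
  G.IsKLStable k l ∧ (G.indepNum : ℤ) = ((Fintype.card V : ℤ) - k + 1) / 2 + l

/-- `G` is, as a whole, a cycle of odd length (at least `3`). -/
def IsOddCycleGraph {V : Type u} (G : SimpleGraph V) : Prop :=
  ∃ m : ℕ, 3 ≤ m ∧ Odd m ∧ Nonempty (G ≃g cycleGraph m)

/-- Two new vertices `u' = inr 0` and `v' = inr 1` are added to the vertex set, and the edge
`uv` is replaced by the three edges `uu'`, `u'v'`, `v'v`. -/
def evenSubdivideEdge {V : Type u} (G : SimpleGraph V) (x y : V) : SimpleGraph (V ⊕ Fin 2) :=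
  (G.deleteEdges {s(x, y)}).map Function.Embedding.inl ⊔
    fromEdgeSet {s(Sum.inl x, Sum.inr 0), s(Sum.inr 0, Sum.inr 1), s(Sum.inr 1, Sum.inl y)}

/-- `G.IsEvenSubdivision H` says that, up to isomorphism, `H` is obtained from `G` by finitely
many (possibly zero) operations, each replacing an edge by a path with two new inner vertices. -/
inductive IsEvenSubdivision {V : Type u} (G : SimpleGraph V) :
    {W : Type v} → SimpleGraph W → Prop
  | of_iso {W : Type v} {H : SimpleGraph W} (e : H ≃g G) : IsEvenSubdivision G H
  | step {W W' : Type v} {H : SimpleGraph W} {H' : SimpleGraph W'} (x y : W)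
      (hH : IsEvenSubdivision G H) (hxy : H.Adj x y) (e : H' ≃g H.evenSubdivideEdge x y) :
      IsEvenSubdivision G H'

end SimpleGraph

/-!
Call a graph *pair-avoiding* with parameter `a` if its independence number is `a` and every two
vertices are missed by some maximum independent set. A `(2, 0)`-stable graph with at least two
vertices has this property; a `(1, 0)`-stable one has the analogue for single vertices.

**Expansion.** If `J` is a maximum independent set and `Y` is independent, exchanging `N(Y) ∩ J` for
`Y \ J` shows `|Y \ J| ≤ |N(Y) ∩ J|`, while the neighbours of `Y ∩ J` lie outside `J`. Choosing `J`
to miss a vertex `v ∈ Y` and `r` neighbours of `v`, induction on `Y` gives `|N(Y)| ≥ |Y| + r`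
(`card_add_le_card_of_adj_mem`).

**`k = 1`.** With `r = 0`, Hall's theorem provides a permutation `σ` of the vertices with `v` adjacent
to `σ v` for all `v` (`exists_perm_adj`). A maximum independent set `I` is disjoint from `σ I`. If
`n = 2|I|` the pairs `x, σ x` for `x ∈ I` form a perfect matching; if `n = 2|I| + 1` one vertex `z` is
left over, the cycle of `σ` through `z` is odd, and the pairs outside this cycle form a matching.

**`k = 2`, `n` odd.** A pair `x, σ x` off the odd cycle could not be missed by a maximum
independent set, so `σ` is a single `n`-cycle. The maximum independent set missing `p` and `σ p` is
`{σ² p, σ⁴ p, …, σⁿ⁻¹ p}`, and the independence of these sets excludes all chords.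

**`k = 2`, `n` even.** By induction on the independence number `a`, where `n = 2a + 2`, either the
vertices split into two parts of odd size each of which has all its independent sets smaller than half
the part, or there is a spanning even subdivision of `K₄`
(`IsPairAvoiding.hasOddSplit_or_exists_isEvenSubdivision`). In the former case both parts fall under
the case of odd `n`, so they induce odd cycles. For the induction, first delete edges as long as the
independence number stays the same. Every vertex has degree at least two.
* If all degrees are at least three, the expansion lemma with `r = 2` shows that for three edges
  `v wᵢ` the critical independent sets `Sᵢ` (of size `a + 1` once `v wᵢ` is deleted) pairwise meet in
  `v` only. Hence `3a + 1 ≤ 2a + 2`, so `a = 1` and the graph is `K₄`.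
* If `v` has just two neighbours and they are adjacent, this triangle is one part of an odd split.
* If `v` has just two neighbours `a`, `b` and they are not adjacent, contracting the path `a v b`
  yields a smaller pair-avoiding graph. What it contains lifts back: a split because one part
  regains two vertices, and a subdivision of `K₄` because its edges at the contracted vertex cannot
  all come from the same one of `a` and `b`, so one of them is to be replaced by a path of length
  three.
-/

namespace SimpleGraph

open Finset

/-! ### Neighbourhoods of independent sets -/

section Expansion

variable {V : Type u} {G : SimpleGraph V} {a : ℕ}

theorem IsIndepSet.not_adj {s : Set V} (hs : G.IsIndepSet s) {x y : V} (hx : x ∈ s) (hy : y ∈ s) :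
    ¬G.Adj x y :=
  fun h => hs hx hy h.ne h

/-- The exchange argument behind all lower bounds on neighbourhoods: for `J` a maximum independent
set, replacing `J ∩ N` by `Y \ J` keeps `J` independent. -/
theorem card_sdiff_le_card_inter [DecidableEq V] (hmax : ∀ J : Finset V, G.IsIndepSet J → #J ≤ a)
    {J Y N : Finset V} (hJ : G.IsIndepSet J) (hJa : a ≤ #J) (hY : G.IsIndepSet Y)
    (hN : ∀ x ∈ Y, ∀ w, G.Adj x w → w ∈ N) : #(Y \ J) ≤ #(N ∩ J) := by
  have hI : G.IsIndepSet ((Y \ J ∪ J \ N : Finset V) : Set V) := by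
    intro p hp q hq _ hpq
    simp only [mem_coe, mem_union, mem_sdiff] at hp hq
    rcases hp with hp | hp <;> rcases hq with hq | hq
    · exact hY.not_adj hp.1 hq.1 hpq
    · exact hq.2 (hN p hp.1 q hpq)
    · exact hp.2 (hN q hq.1 p hpq.symm)
    · exact hJ.not_adj hp.1 hq.1 hpq
  have h1 := hmax _ hI
  rw [card_union_of_disjoint (disjoint_sdiff_self_left.mono_right sdiff_subset)] at h1
  have h2 := card_sdiff_add_card_inter J N
  rw [inter_comm] at h2
  omega

/-- If every vertex `v` is missed by a maximum independent set that also misses `r` neighbours of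
`v`, then every nonempty independent set `Y` has at least `#Y + r` neighbours. -/
theorem card_add_le_card_of_adj_mem (r : ℕ)
    (hmax : ∀ J : Finset V, G.IsIndepSet J → #J ≤ a)
    (havoid : ∀ v, ∃ J R : Finset V, G.IsIndepSet J ∧ a ≤ #J ∧ v ∉ J ∧ r ≤ #R ∧
      ∀ w ∈ R, G.Adj v w ∧ w ∉ J)
    (Y N : Finset V) (hne : Y.Nonempty) (hY : G.IsIndepSet Y)
    (hN : ∀ x ∈ Y, ∀ w, G.Adj x w → w ∈ N) : #Y + r ≤ #N := by
  classical
  induction Y using Finset.strongInduction generalizing N with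
  | H Y ih =>
    obtain ⟨v, hv⟩ := hne
    obtain ⟨J, R, hJ, hJa, hvJ, hR, hRJ⟩ := havoid v
    have h1 := card_sdiff_le_card_inter hmax hJ hJa hY hN
    have h2 := card_sdiff_add_card_inter N J
    have h3 := card_sdiff_add_card_inter Y J
    rcases (Y ∩ J).eq_empty_or_nonempty with h0 | h0
    · have h4 : R ⊆ N \ J := fun w hw =>
        mem_sdiff.2 ⟨hN v hv w (hRJ w hw).1, (hRJ w hw).2⟩
      have h5 := card_le_card h4
      rw [h0, card_empty] at h3
      omega
    · have hss : Y ∩ J ⊂ Y :=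
        ⟨inter_subset_left, fun h => hvJ (mem_inter.1 (h hv)).2⟩
      -- the neighbours of `Y ∩ J` lie outside `J`
      have h4 := ih (Y ∩ J) hss (N \ J) h0 (hY.mono (by simp)) fun x hx w hxw => by
        rw [mem_inter] at hx
        exact mem_sdiff.2 ⟨hN x hx.1 w hxw, fun hw => hJ.not_adj hx.2 hw hxw⟩
      omega

/-- If every vertex is missed by some maximum independent set then `G` has a fractional perfect
matching, here encoded as a permutation moving every vertex to one of its neighbours: its
`2`-cycles are matching edges and its longer cycles are cycles of `G`. -/
theorem exists_perm_adj [Fintype V] (hmax : ∀ J : Finset V, G.IsIndepSet J → #J ≤ a)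
    (havoid : ∀ v, ∃ J : Finset V, G.IsIndepSet J ∧ a ≤ #J ∧ v ∉ J) :
    ∃ σ : Equiv.Perm V, ∀ v, G.Adj v (σ v) := by
  classical
  have key : ∀ S : Finset V, #S ≤ #(S.biUnion fun v => G.neighborFinset v) := by
    intro S
    set N := S.biUnion fun v => G.neighborFinset v with hNdef
    have hN : ∀ x ∈ S, ∀ w, G.Adj x w → w ∈ N := fun x hx w hw =>
      mem_biUnion.2 ⟨x, hx, by simpa using hw⟩
    -- the vertices of `S` without neighbour in `S` form an independent set
    have h1 : #(S \ N) ≤ #(N \ S) := by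
      rcases (S \ N).eq_empty_or_nonempty with h0 | h0
      · simp [h0]
      refine card_add_le_card_of_adj_mem 0 hmax (fun v => ?_) (S \ N) (N \ S) h0 ?_ ?_
      · obtain ⟨J, hJ⟩ := havoid v
        exact ⟨J, ∅, hJ.1, hJ.2.1, hJ.2.2, by simp, by simp⟩
      · intro p hp q hq _ hpq
        simp only [mem_coe, mem_sdiff] at hp hq
        exact hq.2 (hN p hp.1 q hpq)
      · intro x hx w hxw
        rw [mem_sdiff] at hx ⊢
        exact ⟨hN x hx.1 w hxw, fun hw => hx.2 (hN w hw x hxw.symm)⟩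
    have h2 := card_sdiff_add_card_inter S N
    have h3 := card_sdiff_add_card_inter N S
    rw [inter_comm] at h3
    omega
  obtain ⟨f, hf, hfa⟩ := (all_card_le_biUnion_card_iff_exists_injective _).1 key
  exact ⟨Equiv.ofBijective f (Finite.injective_iff_bijective.1 hf), fun v => by
    simpa using hfa v⟩

end Expansion

/-! ### Cycles and matchings from a permutation along edges -/

section PermutationSubgraphs

variable {V : Type u} {G : SimpleGraph V} {σ : Equiv.Perm V}

theorem IsIndepSet.apply_notMem {J : Set V} (hσ : ∀ v, G.Adj v (σ v)) (hJ : G.IsIndepSet J)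
    {x : V} (hx : x ∈ J) : σ x ∉ J :=
  fun h => hJ.not_adj hx h (hσ x)

/-- The subgraph formed by the edges joining `x` to `σ x`, for `x ∈ X`. -/
def pairSubgraph (hσ : ∀ v, G.Adj v (σ v)) (X : Set V) : G.Subgraph where
  verts := X ∪ σ '' X
  Adj x y := (x ∈ X ∧ σ x = y) ∨ (y ∈ X ∧ σ y = x)
  adj_sub := by
    rintro x y (⟨_, rfl⟩ | ⟨_, rfl⟩)
    exacts [hσ _, (hσ _).symm]
  edge_vert := by
    rintro x y (⟨h, _⟩ | ⟨h, rfl⟩)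
    exacts [Or.inl h, Or.inr ⟨_, h, rfl⟩]
  symm := ⟨fun _ _ h => h.symm⟩

theorem pairSubgraph_isMatching (hσ : ∀ v, G.Adj v (σ v)) {X : Set V}
    (hX : ∀ x ∈ X, σ x ∉ X) : (pairSubgraph hσ X).IsMatching := by
  rintro v (hv | ⟨w, hw, rfl⟩)
  · refine ⟨σ v, Or.inl ⟨hv, rfl⟩, ?_⟩
    rintro y (⟨_, h⟩ | ⟨hy, rfl⟩)
    exacts [h.symm, absurd hv (hX y hy)]
  · refine ⟨w, Or.inr ⟨hw, rfl⟩, ?_⟩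
    rintro y (⟨h, _⟩ | ⟨_, h⟩)
    exacts [absurd h (hX w hw), σ.injective h]

/-- The subgraph formed by the cycle of `σ` through `z`. -/
def orbitSubgraph (hσ : ∀ v, G.Adj v (σ v)) (z : V) : G.Subgraph where
  verts := {x | σ.SameCycle z x}
  Adj x y := σ.SameCycle z x ∧ (σ x = y ∨ σ y = x)
  adj_sub := by
    rintro x y ⟨_, rfl | rfl⟩
    exacts [hσ _, (hσ _).symm]
  edge_vert h := h.1
  symm := ⟨by
    rintro x y ⟨h, rfl | rfl⟩
    · exact ⟨Equiv.Perm.sameCycle_apply_right.2 h, Or.inr rfl⟩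
    · exact ⟨Equiv.Perm.sameCycle_apply_right.1 h, Or.inl rfl⟩⟩

/-- A graph whose edges join each vertex to its image under a permutation that acts transitively
is a cycle. -/
theorem nonempty_iso_cycleGraph [Fintype V] (hσ : σ.IsCycleOn (univ : Finset V))
    (hadj : ∀ x y, G.Adj x y ↔ σ x = y ∨ σ y = x) (z : V) (hcard : 2 ≤ Fintype.card V) :
    Nonempty (G ≃g cycleGraph (Fintype.card V)) := by
  obtain ⟨m, hm⟩ : ∃ m, Fintype.card V = m + 2 := ⟨Fintype.card V - 2, by omega⟩
  rw [hm]
  let f : Fin (m + 2) → V := fun i => (σ ^ (i : ℕ)) z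
  have hsurj : Function.Surjective f := by
    intro x
    obtain ⟨i, hi, hx⟩ := hσ.exists_pow_eq (mem_univ z) (mem_univ x)
    rw [card_univ, hm] at hi
    exact ⟨⟨i, hi⟩, hx⟩
  have hbij : Function.Bijective f :=
    (Fintype.bijective_iff_surjective_and_card f).2 ⟨hsurj, by simp [hm]⟩
  have hstep : ∀ i, f (i + 1) = σ (f i) := by
    intro i
    change (σ ^ ((i + 1 : Fin (m + 2)) : ℕ)) z = σ ((σ ^ (i : ℕ)) z)
    rw [← Equiv.Perm.mul_apply, ← pow_succ', hσ.pow_apply_eq_pow_apply (mem_univ z), card_univ, hm,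
      Fin.val_add, Fin.val_one]
    exact Nat.mod_modEq _ _
  refine ⟨RelIso.symm ⟨Equiv.ofBijective f hbij, ?_⟩⟩
  intro i j
  simp only [Equiv.ofBijective_apply, hadj, cycleGraph_adj, ← hstep, hbij.1.eq_iff]
  constructor
  · rintro (h | h)
    · exact Or.inr (by rw [← h]; abel)
    · exact Or.inl (by rw [← h]; abel)
  · rintro (h | h)
    · exact Or.inr (by rw [← h]; abel)
    · exact Or.inl (by rw [← h]; abel)

theorem IsIndepSet.disjoint_image [DecidableEq V] (hσ : ∀ v, G.Adj v (σ v)) {J : Finset V}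
    (hJ : G.IsIndepSet J) : Disjoint J (J.image σ) :=
  Finset.disjoint_left.2 fun x hx hx' =>
    let ⟨_, hy, hyx⟩ := mem_image.1 hx'
    hJ.apply_notMem hσ hy (by rwa [hyx])

theorem IsIndepSet.two_mul_card_le [DecidableEq V] (hσ : ∀ v, G.Adj v (σ v)) {J A : Finset V}
    (hJ : G.IsIndepSet J) (hJA : J ⊆ A) (hA : ∀ x ∈ A, σ x ∈ A) : 2 * #J ≤ #A := by
  have h1 := hJ.disjoint_image hσ
  have h2 := card_le_card (union_subset hJA (image_subset_iff.2 fun x hx => hA x (hJA hx)))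
  rw [card_union_of_disjoint h1, card_image_of_injective _ σ.injective] at h2
  omega

/-- An independent set `I` of half the vertices and its image under `σ` partition the vertices. -/
theorem exists_isPerfectMatching [Fintype V] (hσ : ∀ v, G.Adj v (σ v)) {I : Finset V}
    (hI : G.IsIndepSet I) (hcard : Fintype.card V = 2 * #I) :
    ∃ M : G.Subgraph, M.IsPerfectMatching := by
  classical
  refine ⟨pairSubgraph hσ (I : Set V),
    pairSubgraph_isMatching hσ fun x hx => hI.apply_notMem hσ hx, fun x => ?_⟩
  have h1 := hI.disjoint_image hσ
  have h2 : I ∪ I.image σ = univ := by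
    rw [← card_eq_iff_eq_univ, card_union_of_disjoint h1,
      card_image_of_injective _ σ.injective]
    omega
  have h3 : x ∈ I ∪ I.image σ := h2 ▸ mem_univ x
  rw [mem_union, mem_image] at h3
  exact h3

/-- If `I` is independent and has `(n - 1) / 2` elements then `I` and `σ I` leave out a single
vertex `z`. The cycle of `σ` through `z` is odd because apart from `z` it is made up of
pairs `x`, `σ x` with `x ∈ I`. -/
theorem exists_odd_orbit [Fintype V] [DecidableEq V] [DecidableRel σ.SameCycle]
    (hσ : ∀ v, G.Adj v (σ v)) {I : Finset V}
    (hI : G.IsIndepSet I) (hcard : Fintype.card V = 2 * #I + 1) :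
    ∃ z : V, #{x | σ.SameCycle z x} = 2 * #{x ∈ I | σ.SameCycle z x} + 1 ∧
      ∀ x, ¬σ.SameCycle z x → x ∈ I ∨ ∃ y ∈ I, σ y = x := by
  have h1 := hI.disjoint_image hσ
  have h2 : #(I ∪ I.image σ)ᶜ = 1 := by
    rw [card_compl, card_union_of_disjoint h1, card_image_of_injective _ σ.injective]
    omega
  obtain ⟨z, hz⟩ := card_eq_one.1 h2
  have hz' : ∀ x, x = z ∨ x ∈ I ∨ ∃ y ∈ I, σ y = x := by
    intro x
    by_cases hx : x ∈ (I ∪ I.image σ)ᶜ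
    · rw [hz, mem_singleton] at hx
      exact Or.inl hx
    · rw [mem_compl, not_not, mem_union, mem_image] at hx
      exact Or.inr hx
  have hzI : z ∉ I ∪ I.image σ := by
    rw [← mem_compl, hz]
    exact mem_singleton_self z
  refine ⟨z, ?_, fun x hx => (hz' x).resolve_left fun h => hx (h ▸ Equiv.Perm.SameCycle.refl _ _)⟩
  have h3 : ({x | σ.SameCycle z x} : Finset V) =
      insert z ({x ∈ I | σ.SameCycle z x} ∪ ({x ∈ I | σ.SameCycle z x}).image σ) := by
    ext x
    simp only [mem_filter, mem_univ, true_and, mem_insert, mem_union, mem_image]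
    constructor
    · intro hx
      rcases hz' x with h | h | ⟨y, hy, rfl⟩
      · exact Or.inl h
      · exact Or.inr (Or.inl ⟨h, hx⟩)
      · exact Or.inr (Or.inr ⟨y, ⟨hy, Equiv.Perm.sameCycle_apply_right.1 hx⟩, rfl⟩)
    · rintro (rfl | ⟨_, h⟩ | ⟨y, ⟨_, h⟩, rfl⟩)
      exacts [Equiv.Perm.SameCycle.refl _ _, h, Equiv.Perm.sameCycle_apply_right.2 h]
  rw [h3, card_insert_of_notMem, card_union_of_disjoint, card_image_of_injective _ σ.injective]
  · omega
  · exact h1.mono (filter_subset _ _) (image_subset_image (filter_subset _ _))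
  · exact fun h => hzI (union_subset_union (filter_subset _ _)
      (image_subset_image (filter_subset _ _)) h)

theorem isCycleOn_univ [Fintype V] (h : ∀ x y, σ.SameCycle x y) :
    σ.IsCycleOn (univ : Finset V) :=
  ⟨by simp, fun x _ y _ => h x y⟩

theorem orbitSubgraph_coe_isOddCycleGraph [Fintype V] [DecidableEq V] [DecidableRel σ.SameCycle]
    (hσ : ∀ v, G.Adj v (σ v)) (z : V) (hodd : Odd #{x | σ.SameCycle z x}) :
    (orbitSubgraph hσ z).coe.IsOddCycleGraph := by
  let W := (orbitSubgraph hσ z).verts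
  have hW : ∀ x, σ x ∈ W ↔ x ∈ W := fun x => Equiv.Perm.sameCycle_apply_right
  let τ : Equiv.Perm W := σ.subtypePerm hW
  have : Fintype W := Fintype.ofFinite _
  have hc : Fintype.card W = #{x | σ.SameCycle z x} := by
    rw [← Fintype.card_subtype]
    exact Fintype.card_congr (Equiv.refl _)
  have hpos : 1 < Fintype.card W := by
    refine Fintype.one_lt_card_iff.2 ⟨⟨z, Equiv.Perm.SameCycle.refl _ _⟩,
      ⟨σ z, Equiv.Perm.sameCycle_apply_right.2 (Equiv.Perm.SameCycle.refl _ _)⟩, fun h => ?_⟩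
    exact (hσ z).ne (congrArg Subtype.val h)
  have hcyc : τ.IsCycleOn (univ : Finset W) := isCycleOn_univ fun x y =>
    Equiv.Perm.sameCycle_subtypePerm.2 ((show σ.SameCycle z x from x.2).symm.trans y.2)
  refine ⟨Fintype.card W, ?_, hc ▸ hodd, nonempty_iso_cycleGraph hcyc (fun x y => ?_)
    ⟨z, Equiv.Perm.SameCycle.refl _ _⟩ hpos⟩
  · rw [hc] at hpos ⊢
    obtain ⟨k, hk⟩ := hodd
    omega
  · simp only [τ, Subtype.ext_iff, Equiv.Perm.subtypePerm_apply]
    exact ⟨fun h => h.2, fun h => ⟨x.2, h⟩⟩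

theorem exists_odd_cycle_sup_matching [Fintype V] (hσ : ∀ v, G.Adj v (σ v)) {I : Finset V}
    (hI : G.IsIndepSet I) (hcard : Fintype.card V = 2 * #I + 1) :
    ∃ C M : G.Subgraph, C.coe.IsOddCycleGraph ∧ M.IsMatching ∧ Disjoint C.verts M.verts ∧
      (C ⊔ M).IsSpanning := by
  classical
  obtain ⟨z, hodd, hz⟩ := exists_odd_orbit hσ hI hcard
  refine ⟨orbitSubgraph hσ z, pairSubgraph hσ {x | x ∈ I ∧ ¬σ.SameCycle z x},
    orbitSubgraph_coe_isOddCycleGraph hσ z ⟨_, hodd⟩,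
    pairSubgraph_isMatching hσ fun x hx h => hI.apply_notMem hσ hx.1 h.1, ?_, ?_⟩
  · rw [Set.disjoint_left]
    rintro x hx (hx' | ⟨y, hy, rfl⟩)
    · exact hx'.2 hx
    · exact hy.2 (Equiv.Perm.sameCycle_apply_right.1 hx)
  · intro x
    by_cases hx : σ.SameCycle z x
    · exact Or.inl hx
    · rcases hz x hx with h | ⟨y, hy, rfl⟩
      · exact Or.inr (Or.inl ⟨h, hx⟩)
      · exact Or.inr (Or.inr ⟨y, ⟨hy, fun h => hx (Equiv.Perm.sameCycle_apply_right.2 h)⟩, rfl⟩)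

end PermutationSubgraphs

/-! ### Pair-avoiding graphs of odd order -/

section OddCycle

variable {V : Type u} {G : SimpleGraph V} {a : ℕ}

/-- `G` has independence number `a`, and every two vertices (not necessarily distinct) are both
missed by some maximum independent set. The second condition, which asks for size at least `a`, also
ensures that `a` is attained, except that `a` is only an upper bound if there are no vertices. -/
structure IsPairAvoiding (G : SimpleGraph V) (a : ℕ) : Prop where
  card_le : ∀ J : Finset V, G.IsIndepSet J → #J ≤ a
  exists_avoiding : ∀ x y : V, ∃ J : Finset V, G.IsIndepSet J ∧ a ≤ #J ∧ x ∉ J ∧ y ∉ J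

theorem IsPairAvoiding.exists_perm_adj [Fintype V] (h : G.IsPairAvoiding a) :
    ∃ σ : Equiv.Perm V, ∀ v, G.Adj v (σ v) :=
  SimpleGraph.exists_perm_adj h.card_le fun v =>
    let ⟨J, hJ, hJa, hv, _⟩ := h.exists_avoiding v v
    ⟨J, hJ, hJa, hv⟩

/-- If `n = 2 * a + 1` the permutation of `exists_perm_adj` is a single cycle: otherwise a maximum
independent set missing both ends of a pair `x`, `σ x` off the odd cycle would be too small. -/
theorem IsPairAvoiding.isCycleOn [Fintype V] (h : G.IsPairAvoiding a)
    (hcard : Fintype.card V = 2 * a + 1) {σ : Equiv.Perm V} (hσ : ∀ v, G.Adj v (σ v)) :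
    σ.IsCycleOn (univ : Finset V) := by
  classical
  have hne : Nonempty V := Fintype.card_pos_iff.1 (by omega)
  obtain ⟨I, hI, hIa, -⟩ := h.exists_avoiding hne.some hne.some
  have hIa' : #I = a := le_antisymm (h.card_le I hI) hIa
  obtain ⟨z, hodd, hz⟩ := exists_odd_orbit hσ hI (by omega)
  suffices hall : ∀ x, σ.SameCycle z x from
    isCycleOn_univ fun x y => (hall x).symm.trans (hall y)
  by_contra! hex
  obtain ⟨x, hx, hxI⟩ : ∃ x, ¬σ.SameCycle z x ∧ x ∈ I := by
    obtain ⟨x, hx⟩ := hex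
    rcases hz x hx with h | ⟨y, hy, rfl⟩
    · exact ⟨x, hx, h⟩
    · exact ⟨y, fun h => hx (Equiv.Perm.sameCycle_apply_right.2 h), hy⟩
  obtain ⟨J, hJ, hJa, hxJ, hσxJ⟩ := h.exists_avoiding x (σ x)
  -- on the odd cycle `J` is at most as large as `I`
  have h1 : 2 * #{y ∈ J | σ.SameCycle z y} ≤ #{y | σ.SameCycle z y} := by
    refine IsIndepSet.two_mul_card_le hσ (hJ.mono (coe_subset.2 (filter_subset _ _)))
      (fun y hy => ?_) (fun y hy => ?_)
    · simpa using (mem_filter.1 hy).2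
    · simp only [mem_filter, mem_univ, true_and] at hy ⊢
      exact Equiv.Perm.sameCycle_apply_right.2 hy
  -- off the odd cycle it meets each pair at most once, and the pair of `x` not at all
  have h2 : #{y ∈ J | ¬σ.SameCycle z y} ≤ #({y ∈ I | ¬σ.SameCycle z y}.erase x) := by
    refine card_le_card_of_injOn (fun y => if y ∈ I then y else σ.symm y) ?_ ?_
    · intro y hy
      simp only [coe_filter, Set.mem_ofPred_eq, mem_coe, mem_erase, mem_filter] at hy ⊢
      split_ifs with hyI
      · exact ⟨fun e => hxJ (e ▸ hy.1), hyI, hy.2⟩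
      · obtain ⟨w, hw, rfl⟩ := (hz y hy.2).resolve_left hyI
        rw [Equiv.symm_apply_apply]
        exact ⟨fun e => hσxJ (e ▸ hy.1), hw,
          fun e => hy.2 (Equiv.Perm.sameCycle_apply_right.2 e)⟩
    · intro y hy w hw hyw
      simp only [coe_filter, Set.mem_ofPred_eq] at hy hw
      dsimp only at hyw
      split_ifs at hyw with h3 h4 h4
      · exact hyw
      · rw [Equiv.eq_symm_apply] at hyw
        exact absurd (hyw ▸ hw.1) (hJ.apply_notMem hσ hy.1)
      · rw [Equiv.symm_apply_eq] at hyw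
        exact absurd (hyw ▸ hy.1) (hJ.apply_notMem hσ hw.1)
      · exact σ.symm.injective hyw
  rw [card_erase_of_mem (by simp [hx, hxI])] at h2
  have h3 := card_filter_add_card_filter_not (s := J) (fun y => σ.SameCycle z y)
  have h4 := card_filter_add_card_filter_not (s := I) (fun y => σ.SameCycle z y)
  have h5 : 0 < #{y ∈ I | ¬σ.SameCycle z y} := card_pos.2 ⟨x, by simp [hx, hxI]⟩
  omega

/-- The maximum independent set that misses `p` and `σ p` is `{σ² p, σ⁴ p, …, σⁿ⁻¹ p}`. -/
theorem IsPairAvoiding.exists_even_pow_mem [Fintype V] (h : G.IsPairAvoiding a)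
    (hcard : Fintype.card V = 2 * a + 1) {σ : Equiv.Perm V} (hσ : ∀ v, G.Adj v (σ v)) (p : V) :
    ∃ J : Finset V, G.IsIndepSet J ∧
      ∀ i, 2 * i + 2 < Fintype.card V → (σ ^ (2 * i + 2)) p ∈ J := by
  classical
  have hcyc := h.isCycleOn hcard hσ
  obtain ⟨J, hJ, hJa, hpJ, hσpJ⟩ := h.exists_avoiding p (σ p)
  refine ⟨J, hJ, ?_⟩
  have h1 := hJ.disjoint_image hσ
  have h2 : σ p ∉ J ∪ J.image σ := by
    simp [hσpJ, hpJ]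
  have h3 : insert (σ p) (J ∪ J.image σ) = univ := by
    refine eq_univ_of_card _ (le_antisymm (card_le_univ _) ?_)
    rw [card_insert_of_notMem h2, card_union_of_disjoint h1,
      card_image_of_injective _ σ.injective]
    omega
  have h4 : ∀ x, σ x ≠ σ p → x ∉ J → σ x ∈ J := by
    intro x hx hxJ
    have h5 : σ x ∈ insert (σ p) (J ∪ J.image σ) := h3 ▸ mem_univ _
    simpa [hxJ, σ.injective.ne_iff.1 hx] using h5
  have h5 : ∀ j, 0 < j → j < Fintype.card V → (σ ^ j) p ≠ p := by
    intro j hj hj' he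
    rw [hcyc.pow_apply_eq (mem_univ p), card_univ] at he
    exact absurd (Nat.le_of_dvd hj he) (by omega)
  intro i
  induction i with
  | zero =>
    intro hi
    rw [mul_zero, zero_add, pow_succ', Equiv.Perm.mul_apply, pow_one]
    exact h4 _ (fun e => h5 1 one_pos (by omega) (σ.injective e)) hσpJ
  | succ i ih =>
    intro hi
    rw [show 2 * (i + 1) + 2 = (2 * i + 3) + 1 by ring, pow_succ', Equiv.Perm.mul_apply]
    refine h4 _ (fun e => h5 (2 * i + 3) (by omega) (by omega) (σ.injective e)) ?_
    rw [pow_succ', Equiv.Perm.mul_apply]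
    exact hJ.apply_notMem hσ (ih (by omega))

theorem IsPairAvoiding.nonempty_iso_cycleGraph [Fintype V] (h : G.IsPairAvoiding a)
    (hcard : Fintype.card V = 2 * a + 1) :
    3 ≤ Fintype.card V ∧ Nonempty (G ≃g cycleGraph (Fintype.card V)) := by
  classical
  have hne : Nonempty V := Fintype.card_pos_iff.1 (by omega)
  obtain ⟨σ, hσ⟩ := h.exists_perm_adj
  have hcyc := h.isCycleOn hcard hσ
  have h3 : 3 ≤ Fintype.card V := by
    have h1 := h.card_le {hne.some} (by simp)
    rw [card_singleton] at h1
    omega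
  have hpow : (σ ^ Fintype.card V) = 1 := by
    ext x
    rw [← card_univ, hcyc.pow_card_apply (mem_univ x), Equiv.Perm.one_apply]
  -- two vertices at even distance along the cycle lie in a common independent set
  have heven : ∀ x j, 2 * j + 2 < Fintype.card V → ¬G.Adj x ((σ ^ (2 * j)) x) := by
    intro x j hj
    obtain ⟨J, hJ, hmem⟩ := h.exists_even_pow_mem hcard hσ ((σ ^ 2).symm x)
    have hx := hmem 0 (by omega)
    have hy := hmem j hj
    rw [mul_zero, zero_add, Equiv.apply_symm_apply] at hx
    rw [pow_add, Equiv.Perm.mul_apply, Equiv.apply_symm_apply] at hy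
    exact hJ.not_adj hx hy
  refine ⟨h3, SimpleGraph.nonempty_iso_cycleGraph hcyc (fun x y => ⟨fun hxy => ?_, ?_⟩)
    hne.some (by omega)⟩
  · obtain ⟨j, hj, rfl⟩ := hcyc.exists_pow_eq (mem_univ x) (mem_univ y)
    rw [card_univ] at hj
    rcases Nat.even_or_odd j with ⟨k, hk⟩ | ⟨k, hk⟩
    · by_cases hk' : 2 * k + 2 < Fintype.card V
      · exact absurd hxy (by rw [show j = 2 * k by omega]; exact heven x k hk')
      · right
        rw [← Equiv.Perm.mul_apply, ← pow_succ', show j + 1 = Fintype.card V by omega, hpow,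
          Equiv.Perm.one_apply]
    · by_cases hk' : k = 0
      · left
        rw [hk, hk', mul_zero, zero_add, pow_one]
      · -- an odd distance in one direction is an even distance in the other
        refine absurd hxy.symm ?_
        have h4 := heven ((σ ^ j) x) (a - k) (by omega)
        rwa [← Equiv.Perm.mul_apply, ← pow_add, show 2 * (a - k) + j = Fintype.card V by omega,
          hpow, Equiv.Perm.one_apply] at h4
  · rintro (rfl | rfl)
    exacts [hσ _, (hσ _).symm]

end OddCycle

/-! ### Splitting into two odd cycles -/

section OddSplit

variable {V : Type u} {G : SimpleGraph V} {a : ℕ}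

theorem IsPairAvoiding.mono {K : SimpleGraph V} (h : G.IsPairAvoiding a) (hK : K ≤ G)
    (hmax : ∀ J : Finset V, K.IsIndepSet J → #J ≤ a) : K.IsPairAvoiding a :=
  ⟨hmax, fun x y =>
    let ⟨J, hJ, hJ'⟩ := h.exists_avoiding x y
    ⟨J, fun _ hp _ hq hpq e => hJ hp hq hpq (hK e), hJ'⟩⟩

theorem isPairAvoiding_induce {S : Set V} {b : ℕ}
    (hmax : ∀ J : Finset V, G.IsIndepSet J → (∀ x ∈ J, x ∈ S) → #J ≤ b)
    (havoid : ∀ x ∈ S, ∀ y ∈ S, ∃ J : Finset V,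
      G.IsIndepSet J ∧ (∀ z ∈ J, z ∈ S) ∧ b ≤ #J ∧ x ∉ J ∧ y ∉ J) :
    (G.induce S).IsPairAvoiding b := by
  classical
  constructor
  · intro J hJ
    rw [← card_map (Function.Embedding.subtype (· ∈ S))]
    refine hmax _ ?_ (by simp +contextual)
    intro x hx y hy _ hxy
    simp only [coe_map, Set.mem_image, mem_coe, Function.Embedding.subtype_apply] at hx hy
    obtain ⟨x, hx, rfl⟩ := hx
    obtain ⟨y, hy, rfl⟩ := hy
    exact hJ.not_adj hx hy hxy
  · intro x y
    obtain ⟨J, hJ, hJS, hJb, hx, hy⟩ := havoid x x.2 y y.2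
    refine ⟨J.subtype (· ∈ S), ?_, ?_, by simpa using hx, by simpa using hy⟩
    · intro p hp q hq _ hpq
      simp only [mem_coe, mem_subtype] at hp hq
      exact hJ.not_adj hp hq hpq
    · rwa [card_subtype, filter_true_of_mem hJS]

/-- The vertices can be split into a set `A` of odd size and its complement so that every independent
set inside either part has less than half the size of that part. -/
def HasOddSplit [Fintype V] [DecidableEq V] (G : SimpleGraph V) : Prop :=
  ∃ A : Finset V, Odd #A ∧ ∀ J : Finset V, G.IsIndepSet J →
    (J ⊆ A → 2 * #J < #A) ∧ (J ⊆ Aᶜ → 2 * #J < #Aᶜ)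

theorem HasOddSplit.mono [Fintype V] [DecidableEq V] {K : SimpleGraph V} (h : K.HasOddSplit)
    (hK : K ≤ G) : G.HasOddSplit :=
  let ⟨A, hA, hJ⟩ := h
  ⟨A, hA, fun J hJi => hJ J fun _ hp _ hq hpq e => hJi hp hq hpq (hK e)⟩

/-- In an odd split of a graph with `n = 2 * a + 2`, every maximum independent set attains equality
in both parts, so both parts inherit the avoidance property. -/
theorem IsPairAvoiding.exists_induce_of_hasOddSplit [Fintype V] [DecidableEq V]
    (h : G.IsPairAvoiding a) (hcard : Fintype.card V = 2 * a + 2) (hs : G.HasOddSplit) :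
    ∃ A : Finset V, ∃ p q, #A = 2 * p + 1 ∧ #Aᶜ = 2 * q + 1 ∧
      (G.induce (A : Set V)).IsPairAvoiding p ∧ (G.induce ((A : Set V)ᶜ)).IsPairAvoiding q := by
  obtain ⟨A, ⟨p, hp⟩, hA⟩ := hs
  have hc := card_add_card_compl A
  obtain ⟨q, hq⟩ : ∃ q, #Aᶜ = 2 * q + 1 := ⟨a - p, by omega⟩
  have h1 : ∀ J : Finset V, G.IsIndepSet J → #(J ∩ A) ≤ p ∧ #(J \ A) ≤ q := by
    intro J hJ
    have h2 := (hA (J ∩ A) (hJ.mono (coe_subset.2 inter_subset_left))).1 inter_subset_right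
    have h3 := (hA (J \ A) (hJ.mono (coe_subset.2 sdiff_subset))).2
      (fun x hx => mem_compl.2 (mem_sdiff.1 hx).2)
    omega
  refine ⟨A, p, q, hp, hq, isPairAvoiding_induce ?_ ?_, isPairAvoiding_induce ?_ ?_⟩
  · intro J hJ hJA
    have h2 := (h1 J hJ).1
    rwa [inter_eq_left.2 fun x hx => mem_coe.1 (hJA x hx)] at h2
  · intro x _ y _
    obtain ⟨J, hJ, hJa, hx, hy⟩ := h.exists_avoiding x y
    have h2 := h1 J hJ
    have h3 := card_sdiff_add_card_inter J A
    exact ⟨J ∩ A, hJ.mono (coe_subset.2 inter_subset_left),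
      fun z hz => (mem_inter.1 hz).2, by omega, fun e => hx (mem_inter.1 e).1,
      fun e => hy (mem_inter.1 e).1⟩
  · intro J hJ hJA
    have h2 := (h1 J hJ).2
    rwa [sdiff_eq_self_of_disjoint (Finset.disjoint_left.2 fun x hx => by simpa using hJA x hx)] at h2
  · intro x _ y _
    obtain ⟨J, hJ, hJa, hx, hy⟩ := h.exists_avoiding x y
    have h2 := h1 J hJ
    have h3 := card_sdiff_add_card_inter J A
    exact ⟨J \ A, hJ.mono (coe_subset.2 sdiff_subset),
      fun z hz => by simpa using (mem_sdiff.1 hz).2, by omega, fun e => hx (mem_sdiff.1 e).1,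
      fun e => hy (mem_sdiff.1 e).1⟩

theorem isOddCycleGraph_induce [Fintype V] {S : Finset V} {b : ℕ}
    (h : (G.induce (S : Set V)).IsPairAvoiding b) (hcard : #S = 2 * b + 1) :
    ((⊤ : G.Subgraph).induce (S : Set V)).coe.IsOddCycleGraph := by
  have hc : Fintype.card (S : Set V) = 2 * b + 1 := by simpa using hcard
  obtain ⟨h3, ⟨e⟩⟩ := h.nonempty_iso_cycleGraph hc
  rw [← induce_eq_coe_induce_top]
  exact ⟨_, h3, hc ▸ ⟨b, rfl⟩, ⟨e⟩⟩

theorem IsPairAvoiding.exists_two_odd_cycles [Fintype V] [DecidableEq V]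
    (h : G.IsPairAvoiding a) (hcard : Fintype.card V = 2 * a + 2) (hs : G.HasOddSplit) :
    ∃ C₁ C₂ : G.Subgraph, C₁.coe.IsOddCycleGraph ∧ C₂.coe.IsOddCycleGraph ∧
      Disjoint C₁.verts C₂.verts ∧ (C₁ ⊔ C₂).IsSpanning := by
  obtain ⟨A, p, q, hp, hq, hAp, hAq⟩ := h.exists_induce_of_hasOddSplit hcard hs
  rw [← coe_compl] at hAq
  refine ⟨_, _, isOddCycleGraph_induce hAp hp, isOddCycleGraph_induce hAq hq, ?_, fun x => ?_⟩
  · simpa using disjoint_compl_right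
  · by_cases hx : x ∈ A
    · exact Or.inl (by simpa using hx)
    · exact Or.inr (by simpa using hx)

end OddSplit

/-! ### Even subdivisions of the complete graph on four vertices -/

section Subdivision

theorem IsEvenSubdivision.of_iso_right {V : Type u} {G : SimpleGraph V} {W W' : Type v}
    {H : SimpleGraph W} {H' : SimpleGraph W'} (h : G.IsEvenSubdivision H) (e : H' ≃g H) :
    G.IsEvenSubdivision H' := by
  cases h with
  | of_iso e' => exact .of_iso (e.trans e')
  | step x y hH hxy e' => exact .step x y hH hxy (e.trans e')

variable {W : Type v} {H : SimpleGraph W} {x y : W}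

theorem evenSubdivideEdge_adj_inl_inl {p q : W} :
    (H.evenSubdivideEdge x y).Adj (Sum.inl p) (Sum.inl q) ↔ H.Adj p q ∧ s(p, q) ≠ s(x, y) := by
  simp [evenSubdivideEdge]

theorem evenSubdivideEdge_adj_inl_inr {p : W} {i : Fin 2} :
    (H.evenSubdivideEdge x y).Adj (Sum.inl p) (Sum.inr i) ↔ p = x ∧ i = 0 ∨ p = y ∧ i = 1 := by
  simp [evenSubdivideEdge]

theorem evenSubdivideEdge_adj_inr_inr {i j : Fin 2} :
    (H.evenSubdivideEdge x y).Adj (Sum.inr i) (Sum.inr j) ↔ i ≠ j := by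
  fin_cases i <;> fin_cases j <;> simp [evenSubdivideEdge]

/-- The two facts about even subdivisions of `K₄` that are needed: their independent sets are
small, and their vertices have degree at most three. -/
theorem IsEvenSubdivision.indep_and_degree {W : Type v} {H : SimpleGraph W}
    (h : (completeGraph (Fin 4)).IsEvenSubdivision H) :
    Finite W ∧ (∀ J : Finset W, H.IsIndepSet J → 2 * #J + 2 ≤ Nat.card W) ∧
      ∀ p, ∀ F : Finset W, (∀ q ∈ F, H.Adj p q) → #F ≤ 3 := by
  classical
  induction h with
  | @of_iso W H e =>
    have hf : Finite W := Finite.of_equiv _ e.toEquiv.symm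
    have : Fintype W := Fintype.ofFinite W
    have hc : Fintype.card W = 4 := by simpa using Fintype.card_congr e.toEquiv
    have hadj : ∀ p q, p ≠ q → H.Adj p q := fun p q hpq =>
      e.map_rel_iff.1 (by simpa using hpq)
    refine ⟨hf, fun J hJ => ?_, fun p F hF => ?_⟩
    · have h1 : #J ≤ 1 := card_le_one.2 fun p hp q hq => by
        by_contra hpq
        exact hJ.not_adj hp hq (hadj p q hpq)
      rw [Nat.card_eq_fintype_card]
      omega
    · have h1 : F ⊆ univ.erase p := fun q hq => mem_erase.2 ⟨(hF q hq).ne', mem_univ q⟩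
      have h2 := card_le_card h1
      rw [card_erase_of_mem (mem_univ p), card_univ] at h2
      omega
  | @step W W' H H' x y hH hxy e ih =>
    obtain ⟨hf, hindep, hdeg⟩ := ih
    have hf' : Finite W' := Finite.of_equiv _ e.toEquiv.symm
    refine ⟨hf', fun J hJ => ?_, fun p F hF => ?_⟩
    · have hc : Nat.card W' = Nat.card W + 2 := by
        rw [Nat.card_congr e.toEquiv, Nat.card_sum, Nat.card_eq_fintype_card (α := Fin 2),
          Fintype.card_fin]
      set I := J.map e.toEquiv.toEmbedding with hI
      have hIc : #J = #I := (card_map _).symm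
      have hII : ∀ p ∈ I, ∀ q ∈ I, ¬(H.evenSubdivideEdge x y).Adj p q := by
        intro p hpI q hqI
        obtain ⟨p, hp, rfl⟩ := mem_map.1 hpI
        obtain ⟨q, hq, rfl⟩ := mem_map.1 hqI
        exact fun h => hJ.not_adj hp hq (e.map_rel_iff.1 h)
      rw [hIc, ← card_toLeft_add_card_toRight, hc]
      by_cases hx : x ∈ I.toLeft ∧ y ∈ I.toLeft
      · -- both ends of the subdivided edge are used, so neither new vertex is
        rw [mem_toLeft, mem_toLeft] at hx
        have hR : I.toRight = ∅ := by
          rw [eq_empty_iff_forall_notMem]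
          intro i hi
          rw [mem_toRight] at hi
          have h0 := hII _ hx.1 _ hi
          have h1 := hII _ hx.2 _ hi
          rw [evenSubdivideEdge_adj_inl_inr] at h0 h1
          fin_cases i <;> simp_all
        have h1 := hindep (I.toLeft.erase x) (by
          intro p hp q hq _ hpq
          simp only [coe_erase, Set.mem_sdiff, mem_coe, mem_toLeft, Set.mem_singleton_iff] at hp hq
          refine hII _ hp.1 _ hq.1 (evenSubdivideEdge_adj_inl_inl.2 ⟨hpq, fun h => ?_⟩)
          rw [Sym2.eq_iff] at h
          exact h.elim (fun h => hp.2 h.1) fun h => hq.2 h.2)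
        have h2 := card_erase_add_one (mem_toLeft.2 hx.1)
        rw [hR, card_empty]
        omega
      · have hR : #I.toRight ≤ 1 := card_le_one.2 fun i hi j hj => by
          rw [mem_toRight] at hi hj
          simpa [evenSubdivideEdge_adj_inr_inr] using hII _ hi _ hj
        have h1 := hindep I.toLeft (by
          intro p hp q hq _ hpq
          have hp' := hp
          have hq' := hq
          rw [mem_coe, mem_toLeft] at hp hq
          refine hII _ hp _ hq (evenSubdivideEdge_adj_inl_inl.2 ⟨hpq, fun h => ?_⟩)
          rw [Sym2.eq_iff] at h
          rcases h with ⟨rfl, rfl⟩ | ⟨rfl, rfl⟩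
          exacts [hx ⟨hp', hq'⟩, hx ⟨hq', hp'⟩])
        omega
    · set I := F.map e.toEquiv.toEmbedding with hI
      have hIc : #F = #I := (card_map _).symm
      have hII : ∀ q ∈ I, (H.evenSubdivideEdge x y).Adj (e p) q := by
        intro q hqI
        obtain ⟨q, hq, rfl⟩ := mem_map.1 hqI
        exact e.map_rel_iff.2 (hF q hq)
      rw [hIc]
      rcases hp : e p with u | i
      · -- the new neighbour of `x` stands for `y`, and the new neighbour of `y` for `x`
        rw [hp] at hII
        let φ : W ⊕ Fin 2 → W := Sum.elim id ![y, x]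
        rw [← card_image_of_injOn (f := φ) (s := I)]
        · refine hdeg u _ fun q hqI => ?_
          obtain ⟨q, hq, rfl⟩ := mem_image.1 hqI
          have h1 := hII q hq
          rcases q with q | j
          · exact (evenSubdivideEdge_adj_inl_inl.1 h1).1
          · rcases evenSubdivideEdge_adj_inl_inr.1 h1 with ⟨rfl, rfl⟩ | ⟨rfl, rfl⟩
            exacts [hxy, hxy.symm]
        · intro q hq r hr hqr
          have h1 := hII q hq
          have h2 := hII r hr
          have hne := hxy.ne
          rcases q with q | j <;> rcases r with r | k
          · exact congrArg Sum.inl hqr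
          · rw [evenSubdivideEdge_adj_inl_inl] at h1
            rw [evenSubdivideEdge_adj_inl_inr] at h2
            rcases h2 with ⟨rfl, rfl⟩ | ⟨rfl, rfl⟩ <;> simp_all [φ]
          · rw [evenSubdivideEdge_adj_inl_inl] at h2
            rw [evenSubdivideEdge_adj_inl_inr] at h1
            rcases h1 with ⟨rfl, rfl⟩ | ⟨rfl, rfl⟩ <;> simp_all [φ]
          · rw [evenSubdivideEdge_adj_inl_inr] at h1 h2
            rcases h1 with ⟨rfl, rfl⟩ | ⟨rfl, rfl⟩ <;> rcases h2 with ⟨h3, rfl⟩ | ⟨h3, rfl⟩ <;>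
              simp_all
      · rw [hp] at hII
        let z : W := if i = 0 then x else y
        have h1 : I ⊆ {Sum.inl z, Sum.inr (1 - i)} := by
          intro q hq
          have h2 := hII q hq
          rcases q with q | j
          · have h3 := evenSubdivideEdge_adj_inl_inr.1 h2.symm
            rcases h3 with ⟨rfl, rfl⟩ | ⟨rfl, rfl⟩ <;> simp [z]
          · have h3 := evenSubdivideEdge_adj_inr_inr.1 h2
            fin_cases i <;> fin_cases j <;> simp_all
        exact (card_le_card h1).trans (card_le_two.trans (by norm_num))

end Subdivision

/-! ### Contracting a path through a vertex of degree two -/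

section Contraction

variable {V : Type u} {G : SimpleGraph V} {a b v : V} {c : ℕ}

/-- The contraction of the path `a v b`, for a vertex `v` with neighbours `a` and `b` only: `v` and
`b` are removed and `a` also takes over the neighbours of `b`. -/
def contractPath (G : SimpleGraph V) (a v b : V) : SimpleGraph {x : V // x ≠ v ∧ x ≠ b} :=
  (G ⊔ fromRel fun x y => x = a ∧ G.Adj b y).comap Subtype.val

theorem contractPath_adj_of_ne {x y : {x : V // x ≠ v ∧ x ≠ b}} (hx : x.1 ≠ a) (hy : y.1 ≠ a) :
    (G.contractPath a v b).Adj x y ↔ G.Adj x y := by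
  simp [contractPath, hx, hy]

theorem adj_or_adj_of_contractPath_adj {x y : {x : V // x ≠ v ∧ x ≠ b}}
    (h : (G.contractPath a v b).Adj x y) (hx : x.1 = a) : G.Adj a y ∨ G.Adj b y := by
  obtain ⟨x, hx'⟩ := x
  subst hx
  have hne : y.1 ≠ x := fun e => h.ne (Subtype.ext e.symm)
  simpa [contractPath, hne, hne.symm] using h

/-- An independent set of `G` gives rise to one of the contraction, with one vertex fewer: if it
contains both `a` and `b` then `a` stays. -/
theorem exists_indep_contractPath [DecidableEq V] (hv : ∀ w, G.Adj v w ↔ w = a ∨ w = b)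
    {J : Finset V} (hJ : G.IsIndepSet J) :
    ∃ J' : Finset {x : V // x ≠ v ∧ x ≠ b}, (G.contractPath a v b).IsIndepSet J' ∧
      #J ≤ #J' + 1 ∧ ∀ x ∈ J', x.1 ∈ J := by
  have hva := (hv a).2 (Or.inl rfl)
  have hvb := (hv b).2 (Or.inr rfl)
  by_cases hab : a ∈ J ∧ b ∈ J
  · refine ⟨J.subtype _, ?_, ?_, fun x hx => mem_subtype.1 hx⟩
    · intro p hp q hq _ hpq
      rw [mem_coe, mem_subtype] at hp hq
      by_cases hpa : p.1 = a
      · rcases adj_or_adj_of_contractPath_adj hpq hpa with h | h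
        exacts [hJ.not_adj hab.1 hq h, hJ.not_adj hab.2 hq h]
      by_cases hqa : q.1 = a
      · rcases adj_or_adj_of_contractPath_adj hpq.symm hqa with h | h
        exacts [hJ.not_adj hab.1 hp h, hJ.not_adj hab.2 hp h]
      exact hJ.not_adj hp hq ((contractPath_adj_of_ne hpa hqa).1 hpq)
    · rw [card_subtype, ← card_erase_add_one hab.2]
      refine Nat.add_le_add_right (card_le_card fun x hx => ?_) 1
      rw [mem_erase] at hx
      exact mem_filter.2 ⟨hx.2, fun e => hJ.not_adj (e ▸ hx.2) hab.2 hvb, hx.1⟩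
  · refine ⟨(J.erase a).subtype _, ?_, ?_, fun x hx => mem_of_mem_erase (mem_subtype.1 hx)⟩
    · intro p hp q hq _ hpq
      rw [mem_coe, mem_subtype, mem_erase] at hp hq
      exact hJ.not_adj hp.2 hq.2 ((contractPath_adj_of_ne hp.1 hq.1).1 hpq)
    · have h1 : #(J ∩ {a, v, b}) ≤ 1 := card_le_one.2 fun p hp q hq => by
        simp only [mem_inter, mem_insert, mem_singleton] at hp hq
        obtain ⟨hp, hp'⟩ := hp
        obtain ⟨hq, hq'⟩ := hq
        have h2 := hJ.not_adj hp hq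
        have h3 := hJ.not_adj hq hp
        rcases hp' with rfl | rfl | rfl <;> rcases hq' with rfl | rfl | rfl <;> tauto
      rw [card_subtype, ← card_sdiff_add_card_inter J {a, v, b}]
      refine add_le_add (card_le_card fun x hx => ?_) h1
      simp only [mem_sdiff, mem_insert, mem_singleton, not_or] at hx
      exact mem_filter.2 ⟨mem_erase.2 ⟨hx.2.1, hx.1⟩, hx.2.2⟩

theorem IsPairAvoiding.contractPath [DecidableEq V] (h : G.IsPairAvoiding (c + 1))
    (hv : ∀ w, G.Adj v w ↔ w = a ∨ w = b) (hab : a ≠ b) (hnab : ¬G.Adj a b) :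
    (G.contractPath a v b).IsPairAvoiding c := by
  have hva := (hv a).2 (Or.inl rfl)
  constructor
  · intro J hJ
    set I := J.map (Function.Embedding.subtype _) with hI
    have hIc : #J = #I := (card_map _).symm
    have hmem : ∀ x ∈ I, x ≠ v ∧ x ≠ b := by
      intro x hx
      obtain ⟨x, -, rfl⟩ := mem_map.1 hx
      exact x.2
    have hII : ∀ p ∈ I, ∀ q ∈ I, ¬G.Adj p q := by
      intro p hpI q hqI hpq
      obtain ⟨p, hp, rfl⟩ := mem_map.1 hpI
      obtain ⟨q, hq, rfl⟩ := mem_map.1 hqI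
      exact hJ.not_adj hp hq (Or.inl hpq)
    -- `b` (if `a` is used) or `v` (otherwise) can be added
    obtain ⟨w, hwI, hw⟩ : ∃ w, w ∉ I ∧ ∀ p ∈ I, ¬G.Adj w p := by
      by_cases haI : a ∈ I
      · refine ⟨b, fun e => (hmem b e).2 rfl, fun p hpI hbp => ?_⟩
        obtain ⟨a', ha', hea⟩ := mem_map.1 haI
        obtain ⟨p', hp', hep⟩ := mem_map.1 hpI
        refine hJ.not_adj ha' hp' (Or.inr ?_)
        rw [Function.Embedding.subtype_apply] at hea hep
        have hne : p ≠ a := fun e => hnab (e ▸ hbp.symm)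
        rw [hea, hep, fromRel_adj]
        exact ⟨hne.symm, Or.inl ⟨rfl, hbp⟩⟩
      · refine ⟨v, fun e => (hmem v e).1 rfl, fun p hpI hvp => ?_⟩
        rcases (hv p).1 hvp with rfl | rfl
        exacts [haI hpI, (hmem p hpI).2 rfl]
    have h1 := h.card_le (insert w I) (by
      intro p hp q hq _ hpq
      simp only [coe_insert, Set.mem_insert_iff, mem_coe] at hp hq
      rcases hp with rfl | hp <;> rcases hq with rfl | hq
      exacts [hpq.ne rfl, hw q hq hpq, hw p hp hpq.symm, hII p hp q hq hpq])
    rw [card_insert_of_notMem hwI] at h1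
    omega
  · intro x y
    obtain ⟨J, hJ, hJc, hx, hy⟩ := h.exists_avoiding x y
    obtain ⟨J', hJ', hc, hsub⟩ := exists_indep_contractPath hv hJ
    exact ⟨J', hJ', by omega, fun e => hx (hsub _ e), fun e => hy (hsub _ e)⟩

theorem card_subtype_ne_and_ne [Fintype V] [DecidableEq V] (hvb : v ≠ b) :
    Fintype.card {x : V // x ≠ v ∧ x ≠ b} + 2 = Fintype.card V := by
  have h1 : ({x | x ≠ v ∧ x ≠ b} : Finset V) = (univ.erase v).erase b := by
    ext x
    simp [and_comm]
  rw [Fintype.card_subtype, h1, card_erase_of_mem (by simp [hvb.symm]),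
    card_erase_of_mem (mem_univ _), card_univ]
  have := Fintype.one_lt_card_iff.2 ⟨v, b, hvb⟩
  omega

/-- The part of the split that contains the contracted vertex regains `v` and `b`. -/
theorem HasOddSplit.of_contractPath [Fintype V] [DecidableEq V]
    (hv : ∀ w, G.Adj v w ↔ w = a ∨ w = b) (hab : a ≠ b)
    (hG : Even (Fintype.card V)) (h : (G.contractPath a v b).HasOddSplit) : G.HasOddSplit := by
  have hva := (hv a).2 (Or.inl rfl)
  have hvb := (hv b).2 (Or.inr rfl)
  have hcard := card_subtype_ne_and_ne hvb.ne
  let a' : {x : V // x ≠ v ∧ x ≠ b} := ⟨a, hva.ne', hab⟩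
  obtain ⟨A, hA, haA, hJA⟩ : ∃ A : Finset {x : V // x ≠ v ∧ x ≠ b}, Odd #A ∧ a' ∈ A ∧
      ∀ J : Finset _, (G.contractPath a v b).IsIndepSet J →
        (J ⊆ A → 2 * #J < #A) ∧ (J ⊆ Aᶜ → 2 * #J < #Aᶜ) := by
    obtain ⟨A, hA, hJA⟩ := h
    by_cases haA : a' ∈ A
    · exact ⟨A, hA, haA, hJA⟩
    · refine ⟨Aᶜ, ?_, mem_compl.2 haA, fun J hJ => ⟨(hJA J hJ).2, ?_⟩⟩
      · obtain ⟨k, hk⟩ := hA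
        obtain ⟨m, hm⟩ := hG
        have := card_add_card_compl A
        exact ⟨m - k - 2, by omega⟩
      · rw [compl_compl]
        exact (hJA J hJ).1
  have hmap : ∀ x : V, x ∈ A.map (Function.Embedding.subtype _) ↔
      ∃ hx : x ≠ v ∧ x ≠ b, ⟨x, hx⟩ ∈ A := by
    intro x
    simp only [mem_map, Function.Embedding.subtype_apply]
    exact ⟨fun ⟨y, hy, hyx⟩ => hyx ▸ ⟨y.2, hy⟩, fun ⟨hx, hxA⟩ => ⟨_, hxA, rfl⟩⟩
  set B : Finset V := insert v (insert b (A.map (Function.Embedding.subtype _))) with hB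
  have hBc : #B = #A + 2 := by
    rw [hB, card_insert_of_notMem, card_insert_of_notMem, card_map]
    · rw [hmap]
      exact fun ⟨hx, _⟩ => hx.2 rfl
    · rw [mem_insert, hmap]
      rintro (h | ⟨hx, _⟩)
      exacts [hvb.ne h, hx.1 rfl]
  have hBc' : #Bᶜ = #Aᶜ := by
    have h1 := card_add_card_compl A
    have h2 := card_add_card_compl B
    omega
  have hmemB : ∀ x : {x : V // x ≠ v ∧ x ≠ b}, x.1 ∈ B ↔ x ∈ A := by
    intro x
    rw [hB, mem_insert, mem_insert, hmap]
    exact ⟨fun h => (h.resolve_left x.2.1 |>.resolve_left x.2.2).2,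
      fun h => Or.inr (Or.inr ⟨x.2, h⟩)⟩
  refine ⟨B, hBc ▸ hA.add_even even_two, fun J hJ => ⟨fun hJB => ?_, fun hJB => ?_⟩⟩
  · obtain ⟨J', hJ', hc, hsub⟩ := exists_indep_contractPath hv hJ
    have := (hJA J' hJ').1 fun x hx => (hmemB x).1 (hJB (hsub x hx))
    omega
  · have hJv : ∀ x ∈ J, x ≠ v ∧ x ≠ b ∧ x ≠ a := by
      intro x hx
      have hxB := mem_compl.1 (hJB hx)
      refine ⟨fun e => hxB ?_, fun e => hxB ?_, fun e => hxB ?_⟩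
      · simp [hB, e]
      · simp [hB, e]
      · rw [e]
        exact (hmemB a').2 haA
    have h1 := (hJA (J.subtype _) (by
      intro p hp q hq _ hpq
      rw [mem_coe, mem_subtype] at hp hq
      exact hJ.not_adj hp hq
        ((contractPath_adj_of_ne (hJv _ hp).2.2 (hJv _ hq).2.2).1 hpq))).2 (fun x hx => by
      rw [mem_subtype] at hx
      rw [mem_compl, ← hmemB]
      exact mem_compl.1 (hJB hx))
    rw [card_subtype, filter_true_of_mem fun x hx => ⟨(hJv x hx).1, (hJv x hx).2.1⟩] at h1
    omega

/-- Undoing a contraction. `K` is an even subdivision of `K₄` on all vertices of `G` but the two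
ends of an edge `v b`; its edges lie in `G`, except that one neighbour `y` of `a'` may be adjacent
to `b` instead. The exceptional edge exists, since otherwise `K` would show that deleting `v` and
`b` lowers the independence number; replacing it by a path through `v` and `b` extends `K`. -/
theorem IsPairAvoiding.exists_isEvenSubdivision_of_embedding [Fintype V]
    (h : G.IsPairAvoiding c) (hcard : Fintype.card V = 2 * c + 2)
    {W : Type u} {K : SimpleGraph W} (hK : (completeGraph (Fin 4)).IsEvenSubdivision K)
    (ψ : W ↪ V) (hvb : G.Adj v b) (hψ : ∀ x, (∃ w, ψ w = x) ↔ x ≠ v ∧ x ≠ b) (a' : W)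
    (hav : G.Adj (ψ a') v) (hne : ∀ p q, p ≠ a' → q ≠ a' → K.Adj p q → G.Adj (ψ p) (ψ q))
    (hor : ∀ q, K.Adj a' q → G.Adj (ψ a') (ψ q) ∨ G.Adj b (ψ q))
    (hone : ∀ p q, K.Adj a' p → K.Adj a' q → ¬G.Adj (ψ a') (ψ p) → ¬G.Adj (ψ a') (ψ q) → p = q) :
    ∃ K' ≤ G, (completeGraph (Fin 4)).IsEvenSubdivision K' := by
  classical
  have hψ' : ∀ w, ψ w ≠ v ∧ ψ w ≠ b := fun w => (hψ _).1 ⟨w, rfl⟩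
  let φ : W ⊕ Fin 2 → V := Sum.elim ψ ![v, b]
  have hφ : Function.Bijective φ := by
    constructor
    · rintro (p | i) (q | j) hpq
      · exact congrArg Sum.inl (ψ.injective hpq)
      · fin_cases j
        exacts [absurd hpq (hψ' p).1, absurd hpq (hψ' p).2]
      · fin_cases i
        exacts [absurd hpq.symm (hψ' q).1, absurd hpq.symm (hψ' q).2]
      · fin_cases i <;> fin_cases j
        exacts [rfl, absurd hpq hvb.ne, absurd hpq hvb.ne', rfl]
    · intro x
      by_cases hx : x ≠ v ∧ x ≠ b
      · obtain ⟨w, hw⟩ := (hψ x).2 hx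
        exact ⟨Sum.inl w, hw⟩
      · by_cases hxv : x = v
        · exact ⟨Sum.inr 0, hxv.symm⟩
        · exact ⟨Sum.inr 1, (by_contra fun e => hx ⟨hxv, fun e' => e e'.symm⟩ : b = x)⟩
  by_cases hex : ∃ y, K.Adj a' y ∧ ¬G.Adj (ψ a') (ψ y)
  · obtain ⟨y, hay, hy⟩ := hex
    let e : W ⊕ Fin 2 ≃ V := Equiv.ofBijective φ hφ
    refine ⟨(K.evenSubdivideEdge a' y).map e.toEmbedding, ?_,
      .step a' y hK hay (Iso.map e _).symm⟩
    rw [map_le_iff_le_comap]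
    have hold : ∀ q, K.Adj a' q → q ≠ y → G.Adj (ψ a') (ψ q) := fun q haq hqy => by
      by_contra hq
      exact hqy (hone q y haq hay hq hy)
    have hnew : ∀ p i, (K.evenSubdivideEdge a' y).Adj (Sum.inl p) (Sum.inr i) →
        G.Adj (φ (Sum.inl p)) (φ (Sum.inr i)) := by
      intro p i hpi
      rcases evenSubdivideEdge_adj_inl_inr.1 hpi with ⟨rfl, rfl⟩ | ⟨rfl, rfl⟩
      · exact hav
      · exact ((hor p hay).resolve_left hy).symm
    rintro (p | i) (q | j) hpq
    · obtain ⟨h1, h2⟩ := evenSubdivideEdge_adj_inl_inl.1 hpq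
      change G.Adj (ψ p) (ψ q)
      by_cases hp : p = a'
      · subst hp
        exact hold q h1 fun e => h2 (by rw [e])
      · by_cases hq : q = a'
        · subst hq
          exact (hold p h1.symm fun e => h2 (by rw [e, Sym2.eq_swap])).symm
        · exact hne p q hp hq h1
    · exact hnew p j hpq
    · exact (hnew q i hpq.symm).symm
    · have h1 := evenSubdivideEdge_adj_inr_inr.1 hpq
      fin_cases i <;> fin_cases j
      exacts [absurd rfl h1, hvb, hvb.symm, absurd rfl h1]
  · push Not at hex
    exfalso
    obtain ⟨-, hindep, -⟩ := hK.indep_and_degree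
    have hf : Finite W := Finite.of_injective ψ ψ.injective
    obtain ⟨J, hJ, hJc, hvJ, hbJ⟩ := h.exists_avoiding v b
    have h1 := hindep (J.preimage ψ ψ.injective.injOn) (by
      intro p hp q hq _ hpq
      rw [mem_coe, mem_preimage] at hp hq
      refine hJ.not_adj hp hq ?_
      by_cases hpa : p = a'
      · subst hpa
        exact hex q hpq
      · by_cases hqa : q = a'
        · subst hqa
          exact (hex p hpq.symm).symm
        · exact hne p q hpa hqa hpq)
    rw [card_preimage, filter_true_of_mem fun x hx => by
      exact (hψ x).2 ⟨fun e => hvJ (e ▸ hx), fun e => hbJ (e ▸ hx)⟩] at h1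
    have h2 := Nat.card_congr (Equiv.ofBijective φ hφ)
    rw [Nat.card_sum, Nat.card_eq_fintype_card (α := Fin 2), Fintype.card_fin,
      Nat.card_eq_fintype_card (α := V)] at h2
    omega

/-- The contracted vertex has degree at most three in `K`, so `a` or `b` accounts for at most one
of its edges. -/
theorem IsPairAvoiding.exists_isEvenSubdivision_of_contractPath [Fintype V]
    (h : G.IsPairAvoiding c) (hcard : Fintype.card V = 2 * c + 2)
    (hv : ∀ w, G.Adj v w ↔ w = a ∨ w = b) (hab : a ≠ b)
    {K : SimpleGraph {x : V // x ≠ v ∧ x ≠ b}} (hKG : K ≤ G.contractPath a v b)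
    (hK : (completeGraph (Fin 4)).IsEvenSubdivision K) :
    ∃ K' ≤ G, (completeGraph (Fin 4)).IsEvenSubdivision K' := by
  classical
  have hva := (hv a).2 (Or.inl rfl)
  have hvb := (hv b).2 (Or.inr rfl)
  let a' : {x : V // x ≠ v ∧ x ≠ b} := ⟨a, hva.ne', hab⟩
  have hor : ∀ q, K.Adj a' q → G.Adj a q ∨ G.Adj b q := fun q hq =>
    adj_or_adj_of_contractPath_adj (hKG hq) rfl
  have hne : ∀ p q, p ≠ a' → q ≠ a' → K.Adj p q → G.Adj p q := fun p q hp hq hpq =>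
    (contractPath_adj_of_ne (fun e => hp (Subtype.ext e)) (fun e => hq (Subtype.ext e))).1
      (hKG hpq)
  let F : Finset {x : V // x ≠ v ∧ x ≠ b} := {q | K.Adj a' q}
  have hF := hK.indep_and_degree.2.2 a' F fun q hq => (mem_filter.1 hq).2
  have hsplit := card_filter_add_card_filter_not (s := F) (fun q => G.Adj a q.1)
  by_cases hR : #{q ∈ F | ¬G.Adj a q.1} ≤ 1
  · refine h.exists_isEvenSubdivision_of_embedding hcard hK (Function.Embedding.subtype _) hvb
      (fun x => ?_) a' hva.symm hne hor fun p q hp hq hp' hq' => ?_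
    · exact ⟨fun ⟨w, hw⟩ => hw ▸ w.2, fun hx => ⟨⟨x, hx⟩, rfl⟩⟩
    · exact card_le_one.1 hR p (by simpa [F] using ⟨hp, hp'⟩) q (by simpa [F] using ⟨hq, hq'⟩)
  · -- exchange the roles of `a` and `b`
    have hP : #{q ∈ F | G.Adj a q.1} ≤ 1 := by omega
    let ψ : {x : V // x ≠ v ∧ x ≠ b} ↪ V :=
      (Function.Embedding.subtype _).trans (Equiv.swap a b).toEmbedding
    have hψa : ψ a' = b := Equiv.swap_apply_left a b
    have hψ : ∀ q, q ≠ a' → ψ q = q.1 := fun q hq =>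
      Equiv.swap_apply_of_ne_of_ne (fun e => hq (Subtype.ext e)) q.2.2
    refine h.exists_isEvenSubdivision_of_embedding hcard hK ψ hva
      (fun x => ?_) a' (by rw [hψa]; exact hvb.symm) (fun p q hp hq hpq => ?_) (fun q hq => ?_)
      fun p q hp hq hp' hq' => ?_
    · constructor
      · rintro ⟨w, rfl⟩
        by_cases hw : w = a'
        · rw [hw, hψa]
          exact ⟨hvb.ne', hab.symm⟩
        · rw [hψ w hw]
          exact ⟨w.2.1, fun e => hw (Subtype.ext e)⟩
      · rintro ⟨hxv, hxa⟩
        by_cases hxb : x = b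
        · exact ⟨a', hψa.trans hxb.symm⟩
        · exact ⟨⟨x, hxv, hxb⟩, hψ _ fun e => hxa (congrArg Subtype.val e)⟩
    · rw [hψ p hp, hψ q hq]
      exact hne p q hp hq hpq
    · rw [hψa, hψ q hq.ne']
      exact (hor q hq).symm
    · rw [hψa, hψ p hp.ne'] at hp'
      rw [hψa, hψ q hq.ne'] at hq'
      exact card_le_one.1 hP p (by simpa [F] using ⟨hp, (hor p hp).resolve_right hp'⟩) q
        (by simpa [F] using ⟨hq, (hor q hq).resolve_right hq'⟩)

end Contraction

/-! ### Edge-critical graphs -/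

section Critical

variable {V : Type u} {G : SimpleGraph V} {a : ℕ}

/-- Deleting edges as long as all independent sets have at most `a` elements leads to an edge-critical
graph `K`: for each edge `x y` of `K` there is a set of size `a + 1` in which `x y` is the only
edge. -/
theorem exists_le_edge_critical [Finite V] (hmax : ∀ J : Finset V, G.IsIndepSet J → #J ≤ a) :
    ∃ K ≤ G, (∀ J : Finset V, K.IsIndepSet J → #J ≤ a) ∧
      ∀ x y, K.Adj x y → ∃ S : Finset V, x ∈ S ∧ y ∈ S ∧ #S = a + 1 ∧
        ∀ p ∈ S, ∀ q ∈ S, K.Adj p q → s(p, q) = s(x, y) := by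
  classical
  have := Fintype.ofFinite V
  obtain ⟨K, hKG, hK⟩ := Finite.exists_le_minimal
    (p := fun K : SimpleGraph V => ∀ J : Finset V, K.IsIndepSet J → #J ≤ a) hmax
  refine ⟨K, hKG, hK.prop, fun x y hxy => ?_⟩
  have h1 : ¬∀ J : Finset V, (K.deleteEdges {s(x, y)}).IsIndepSet J → #J ≤ a := fun h => by
    have h2 : (K.deleteEdges {s(x, y)}).Adj x y := hK.le_of_le h (deleteEdges_le _) hxy
    simp at h2
  push Not at h1
  obtain ⟨S, hS, hSa⟩ := h1
  have hedge : ∀ p ∈ S, ∀ q ∈ S, K.Adj p q → s(p, q) = s(x, y) := by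
    intro p hp q hq hpq
    by_contra hne
    exact hS.not_adj hp hq (by simp only [deleteEdges_adj, Set.mem_singleton_iff]; exact ⟨hpq, hne⟩)
  have hmem : ∀ z ∈ s(x, y), z ∈ S := by
    intro z hz
    by_contra hzS
    refine absurd (hK.prop S fun p hp q hq _ hpq => ?_) (by omega)
    have h3 := hedge p hp q hq hpq
    rw [← h3, Sym2.mem_iff] at hz
    rcases hz with rfl | rfl
    exacts [hzS hp, hzS hq]
  have hx := hmem x (Sym2.mem_mk_left x y)
  refine ⟨S, hx, hmem y (Sym2.mem_mk_right x y), ?_, hedge⟩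
  have h4 := hK.prop (S.erase x) fun p hp q hq _ hpq => by
    rw [mem_coe, mem_erase] at hp hq
    have h5 : x ∈ s(p, q) := hedge p hp.2 q hq.2 hpq ▸ Sym2.mem_mk_left x y
    rw [Sym2.mem_iff] at h5
    exact h5.elim (fun e => hp.1 e.symm) fun e => hq.1 e.symm
  rw [card_erase_of_mem hx] at h4
  omega

/-- In an edge-critical graph with `n = 2 * a + 2` and all degrees at least three, the critical sets
`S₁`, `S₂`, `S₃` of three edges `v w₁`, `v w₂`, `v w₃` pairwise meet in `v` only, because the
neighbours of `S₁ ∩ S₂ \ {v}` lie outside `S₁ ∪ S₂` and would be too few. Hence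
`3 * a + 1 ≤ n`. -/
theorem le_one_of_edge_critical [Fintype V] [Nonempty V]
    (hmax : ∀ J : Finset V, G.IsIndepSet J → #J ≤ a)
    (hcrit : ∀ x y, G.Adj x y → ∃ S : Finset V, x ∈ S ∧ y ∈ S ∧ #S = a + 1 ∧
      ∀ p ∈ S, ∀ q ∈ S, G.Adj p q → s(p, q) = s(x, y))
    (hdeg : ∀ v, ∃ F : Finset V, 3 ≤ #F ∧ ∀ w ∈ F, G.Adj v w)
    (hcard : Fintype.card V = 2 * a + 2) : a ≤ 1 := by
  classical
  have hexp := card_add_le_card_of_adj_mem (G := G) (a := a) 2 hmax (fun v => by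
    obtain ⟨F, hF, hFv⟩ := hdeg v
    obtain ⟨w, hw⟩ : F.Nonempty := card_pos.1 (by omega)
    obtain ⟨S, hvS, hwS, hSa, hS⟩ := hcrit v w (hFv w hw)
    refine ⟨S.erase v, F.erase w, ?_, ?_, notMem_erase v S, ?_, ?_⟩
    · intro p hp q hq _ hpq
      rw [mem_coe, mem_erase] at hp hq
      have h5 : v ∈ s(p, q) := hS p hp.2 q hq.2 hpq ▸ Sym2.mem_mk_left v w
      rw [Sym2.mem_iff] at h5
      exact h5.elim (fun e => hp.1 e.symm) fun e => hq.1 e.symm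
    · rw [card_erase_of_mem hvS]
      omega
    · rw [card_erase_of_mem hw]
      omega
    · intro x hx
      rw [mem_erase] at hx
      refine ⟨hFv x hx.2, fun hxS => hx.1 ?_⟩
      have h5 := hS v hvS x (mem_of_mem_erase hxS) (hFv x hx.2)
      exact Sym2.congr_right.1 h5)
  have v : V := Classical.arbitrary V
  have hinter : ∀ w w' (S S' : Finset V), w ≠ w' → G.Adj v w → G.Adj v w' →
      v ∈ S → w ∈ S → #S = a + 1 → (∀ p ∈ S, ∀ q ∈ S, G.Adj p q → s(p, q) = s(v, w)) →
      v ∈ S' → w' ∈ S' → #S' = a + 1 →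
      (∀ p ∈ S', ∀ q ∈ S', G.Adj p q → s(p, q) = s(v, w')) → S ∩ S' ⊆ {v} := by
    intro w w' S S' hww hvw hvw' hvS hwS hSa hS hvS' hwS' hSa' hS'
    have hw' : w' ∉ S := fun e => hww (Sym2.congr_right.1 (hS v hvS w' e hvw')).symm
    have hw : w ∉ S' := fun e => hww (Sym2.congr_right.1 (hS' v hvS' w e hvw))
    have hout : ∀ x ∈ (S ∩ S').erase v, ∀ z, G.Adj x z → z ∉ S ∪ S' := by
      intro x hx z hxz hz
      simp only [mem_erase, mem_inter] at hx
      rcases mem_union.1 hz with hz | hz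
      · have h1 : x ∈ s(v, w) := hS x hx.2.1 z hz hxz ▸ Sym2.mem_mk_left x z
        rcases Sym2.mem_iff.1 h1 with e | e
        exacts [hx.1 e, hw (e ▸ hx.2.2)]
      · have h1 : x ∈ s(v, w') := hS' x hx.2.2 z hz hxz ▸ Sym2.mem_mk_left x z
        rcases Sym2.mem_iff.1 h1 with e | e
        exacts [hx.1 e, hw' (e ▸ hx.2.1)]
    by_contra hsub
    have hne : ((S ∩ S').erase v).Nonempty := by
      obtain ⟨x, hx, hxv⟩ := not_subset.1 hsub
      exact ⟨x, mem_erase.2 ⟨fun e => hxv (mem_singleton.2 e), hx⟩⟩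
    have h1 := hexp ((S ∩ S').erase v) (S ∪ S')ᶜ hne
      (fun p hp q hq _ hpq => hout p hp q hpq
        (mem_union_left _ (mem_inter.1 (mem_of_mem_erase (mem_coe.1 hq))).1))
      fun x hx z hxz => mem_compl.2 (hout x hx z hxz)
    rw [card_erase_of_mem (mem_inter.2 ⟨hvS, hvS'⟩)] at h1
    have h2 := card_union_add_card_inter S S'
    have h3 := card_add_card_compl (S ∪ S')
    omega
  obtain ⟨F, hF, hFv⟩ := hdeg v
  obtain ⟨w₁, h₁, w₂, h₂, w₃, h₃, h₁₂, h₁₃, h₂₃⟩ := two_lt_card.1 (show 2 < #F by omega)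
  replace h₁ := hFv _ h₁
  replace h₂ := hFv _ h₂
  replace h₃ := hFv _ h₃
  obtain ⟨S₁, hv₁, hw₁, hc₁, hS₁⟩ := hcrit v w₁ h₁
  obtain ⟨S₂, hv₂, hw₂, hc₂, hS₂⟩ := hcrit v w₂ h₂
  obtain ⟨S₃, hv₃, hw₃, hc₃, hS₃⟩ := hcrit v w₃ h₃
  have i₁₂ := card_le_card (hinter _ _ _ _ h₁₂ h₁ h₂ hv₁ hw₁ hc₁ hS₁ hv₂ hw₂ hc₂ hS₂)
  have i₁₃ := hinter _ _ _ _ h₁₃ h₁ h₃ hv₁ hw₁ hc₁ hS₁ hv₃ hw₃ hc₃ hS₃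
  have i₂₃ := hinter _ _ _ _ h₂₃ h₂ h₃ hv₂ hw₂ hc₂ hS₂ hv₃ hw₃ hc₃ hS₃
  have i₁₂₃ : #((S₁ ∪ S₂) ∩ S₃) ≤ #{v} := by
    rw [union_inter_distrib_right]
    exact card_le_card (union_subset i₁₃ i₂₃)
  have h4 := card_union_add_card_inter S₁ S₂
  have h5 := card_union_add_card_inter (S₁ ∪ S₂) S₃
  have h6 := card_le_univ (S₁ ∪ S₂ ∪ S₃)
  rw [card_singleton] at i₁₂ i₁₂₃
  omega

theorem IsPairAvoiding.two_le_card_of_adj_mem (h : G.IsPairAvoiding a) (v : V) (N : Finset V)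
    (hN : ∀ w, G.Adj v w → w ∈ N) : 2 ≤ #N := by
  classical
  by_contra! hlt
  have : Nonempty V := ⟨v⟩
  obtain ⟨w, hw⟩ := card_le_one_iff_subset_singleton.1 (Nat.lt_succ_iff.1 hlt)
  obtain ⟨J, hJ, hJa, hvJ, hwJ⟩ := h.exists_avoiding v w
  have hnot : ∀ x ∈ J, ¬G.Adj v x := fun x hx hvx =>
    hwJ (mem_singleton.1 (hw (hN x hvx)) ▸ hx)
  have h1 := h.card_le (insert v J) (by
    intro p hp q hq _ hpq
    simp only [coe_insert, Set.mem_insert_iff, mem_coe] at hp hq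
    rcases hp with rfl | hp <;> rcases hq with rfl | hq
    exacts [hpq.ne rfl, hnot q hq hpq, hnot p hp hpq.symm, hJ.not_adj hp hq hpq])
  rw [card_insert_of_notMem hvJ] at h1
  omega

/-- A triangle `v p q` in which `v` has degree two is one part of an odd split: `v` can be added to
every independent set that avoids the triangle. -/
theorem hasOddSplit_of_triangle [Fintype V] [DecidableEq V] {v p q : V}
    (hmax : ∀ J : Finset V, G.IsIndepSet J → #J ≤ a) (hcard : Fintype.card V = 2 * a + 2)
    (hv : ∀ w, G.Adj v w ↔ w = p ∨ w = q) (hpq : G.Adj p q) : G.HasOddSplit := by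
  have hvp := (hv p).2 (Or.inl rfl)
  have hvq := (hv q).2 (Or.inr rfl)
  have hc : #{v, p, q} = 3 := card_eq_three.2 ⟨v, p, q, hvp.ne, hvq.ne, hpq.ne, rfl⟩
  have hcc := card_add_card_compl ({v, p, q} : Finset V)
  refine ⟨{v, p, q}, by rw [hc]; decide, fun J hJ => ⟨fun hJA => ?_, fun hJA => ?_⟩⟩
  · have h1 : #J ≤ 1 := card_le_one.2 fun x hx y hy => by
      have hx' := hJA hx
      have hy' := hJA hy
      simp only [mem_insert, mem_singleton] at hx' hy'
      have h2 := hJ.not_adj hx hy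
      have h3 := hJ.not_adj hy hx
      rcases hx' with rfl | rfl | rfl <;> rcases hy' with rfl | rfl | rfl <;> tauto
    omega
  · have hout : ∀ x ∈ J, x ≠ v ∧ x ≠ p ∧ x ≠ q := by
      intro x hx
      simpa using mem_compl.1 (hJA hx)
    have hnot : ∀ x ∈ J, ¬G.Adj v x := fun x hx hvx =>
      ((hv x).1 hvx).elim (hout x hx).2.1 (hout x hx).2.2
    have h1 := hmax (insert v J) (by
      intro x hx y hy _ hxy
      simp only [coe_insert, Set.mem_insert_iff, mem_coe] at hx hy
      rcases hx with rfl | hx <;> rcases hy with rfl | hy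
      exacts [hxy.ne rfl, hnot y hy hxy, hnot x hx hxy.symm, hJ.not_adj hx hy hxy])
    rw [card_insert_of_notMem fun e => (hout v e).1 rfl] at h1
    omega

theorem IsPairAvoiding.hasOddSplit_or_exists_isEvenSubdivision [Fintype V] [DecidableEq V]
    (h : G.IsPairAvoiding a) (hcard : Fintype.card V = 2 * a + 2) :
    G.HasOddSplit ∨ ∃ K ≤ G, (completeGraph (Fin 4)).IsEvenSubdivision K := by
  induction a generalizing V with
  | zero =>
    have hne : Nonempty V := Fintype.card_pos_iff.1 (by omega)
    have := h.card_le {hne.some} (by simp)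
    simp at this
  | succ c ih =>
    have hne : Nonempty V := Fintype.card_pos_iff.1 (by omega)
    obtain ⟨K, hKG, hmax, hcrit⟩ := exists_le_edge_critical h.card_le
    have hK := h.mono hKG hmax
    suffices hs : K.HasOddSplit ∨ ∃ K' ≤ K, (completeGraph (Fin 4)).IsEvenSubdivision K' from
      hs.imp (fun hs => hs.mono hKG) fun ⟨K', hK', hs⟩ => ⟨K', hK'.trans hKG, hs⟩
    by_cases hdeg : ∀ v, ∃ F : Finset V, 3 ≤ #F ∧ ∀ w ∈ F, K.Adj v w
    · have hc := le_one_of_edge_critical hmax hcrit hdeg hcard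
      obtain rfl : c = 0 := by omega
      have htop : ∀ x y, x ≠ y → K.Adj x y := by
        intro x y hxy
        by_contra hn
        have h1 := hmax {x, y} (by
          intro p hp q hq _ hpq
          simp only [coe_insert, coe_singleton, Set.mem_insert_iff, Set.mem_singleton_iff] at hp hq
          rcases hp with rfl | rfl <;> rcases hq with rfl | rfl
          exacts [hpq.ne rfl, hn hpq, hn hpq.symm, hpq.ne rfl])
        rw [card_pair hxy] at h1
        omega
      let e : V ≃ Fin 4 := Fintype.equivFinOfCardEq (by omega)
      refine Or.inr ⟨K, le_rfl, .of_iso ⟨e, fun {x y} => ?_⟩⟩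
      simp only [completeGraph_eq_top, top_adj, ne_eq, e.injective.eq_iff]
      exact ⟨htop x y, fun hxy => hxy.ne⟩
    · push Not at hdeg
      obtain ⟨v, hv⟩ := hdeg
      classical
      have h2 := hK.two_le_card_of_adj_mem v (K.neighborFinset v) fun w hw => by simpa using hw
      have h3 : #(K.neighborFinset v) < 3 := by
        by_contra! hge
        obtain ⟨w, hw, hvw⟩ := hv _ hge
        exact hvw (by simpa using hw)
      obtain ⟨p, q, hpq, hN⟩ := card_eq_two.1 (show #(K.neighborFinset v) = 2 by omega)
      have hv' : ∀ w, K.Adj v w ↔ w = p ∨ w = q := fun w => by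
        rw [← mem_neighborFinset, hN, mem_insert, mem_singleton]
      by_cases hadj : K.Adj p q
      · exact Or.inl (hasOddSplit_of_triangle hmax hcard hv' hadj)
      · have hvq := (hv' q).2 (Or.inr rfl)
        have hc := card_subtype_ne_and_ne hvq.ne
        rcases ih (hK.contractPath hv' hpq hadj) (by omega) with hs | ⟨L, hL, hs⟩
        · exact Or.inl (hs.of_contractPath hv' hpq ⟨c + 2, by omega⟩)
        · exact Or.inr (hK.exists_isEvenSubdivision_of_contractPath hcard hv' hpq hL hs)

end Critical

/-! ### Stable graphs -/

section Stable

variable {V : Type u} {G : SimpleGraph V}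

theorem IsKLStable.exists_avoiding {k : ℕ} (h : G.IsKLStable k 0) (s : Finset V) (hs : #s = k) :
    ∃ J : Finset V, G.IsIndepSet J ∧ G.indepNum ≤ #J ∧ ∀ x ∈ s, x ∉ J := by
  classical
  obtain ⟨J, hJ⟩ := (G.induce ((s : Set V)ᶜ)).exists_isNIndepSet_indepNum
  refine ⟨J.map (Function.Embedding.subtype _), ?_, ?_, ?_⟩
  · intro p hp q hq _ hpq
    rw [mem_coe, mem_map] at hp hq
    obtain ⟨p, hp, rfl⟩ := hp
    obtain ⟨q, hq, rfl⟩ := hq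
    exact hJ.isIndepSet.not_adj hp hq hpq
  · rw [card_map, hJ.card_eq]
    exact h s hs
  · intro x hx hxJ
    obtain ⟨y, -, rfl⟩ := mem_map.1 hxJ
    exact y.2 hx

theorem IsKLStable.isPairAvoiding [Fintype V] (h : G.IsKLStable 2 0) (hcard : 2 ≤ Fintype.card V) :
    G.IsPairAvoiding G.indepNum := by
  classical
  refine ⟨fun J hJ => hJ.card_le_indepNum, fun x y => ?_⟩
  obtain ⟨s, hs, hsc⟩ := exists_superset_card_eq (s := {x, y}) card_le_two hcard
  obtain ⟨J, hJ, hJa, hsJ⟩ := h.exists_avoiding s hsc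
  exact ⟨J, hJ, hJa, hsJ x (hs (by simp)), hsJ y (hs (by simp))⟩

theorem IsKLStable.exists_perm_adj [Fintype V] (h : G.IsKLStable 1 0) :
    ∃ σ : Equiv.Perm V, ∀ v, G.Adj v (σ v) :=
  SimpleGraph.exists_perm_adj (fun _ hJ => hJ.card_le_indepNum) fun v =>
    let ⟨J, hJ, hJa, hv⟩ := h.exists_avoiding {v} (card_singleton v)
    ⟨J, hJ, hJa, hv v (mem_singleton_self v)⟩

end Stable

end SimpleGraph

theorem theorem1p1 {V : Type*} [Fintype V] (G : SimpleGraph V) (k n : ℕ)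
    (hn : Fintype.card V = n) (hG : G.IsTightStable k 0) :
    (k = 1 → Even n → ∃ M : G.Subgraph, M.IsPerfectMatching) ∧
    (k = 1 → Odd n → ∃ H : G.Subgraph, H.IsSpanning ∧
      ∃ C M : G.Subgraph, C.coe.IsOddCycleGraph ∧ M.IsMatching ∧
        Disjoint C.verts M.verts ∧ H = C ⊔ M) ∧
    (k = 2 → Odd n → 3 ≤ n ∧ Nonempty (G ≃g SimpleGraph.cycleGraph n)) ∧
    (k = 2 → Even n → ∃ H : G.Subgraph, H.IsSpanning ∧
      ((∃ C₁ C₂ : G.Subgraph, C₁.coe.IsOddCycleGraph ∧ C₂.coe.IsOddCycleGraph ∧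
          Disjoint C₁.verts C₂.verts ∧ H = C₁ ⊔ C₂) ∨
        (SimpleGraph.completeGraph (Fin 4)).IsEvenSubdivision H.coe)) := by
  classical
  subst hn
  obtain ⟨hstable, hα⟩ := hG
  refine ⟨?_, ?_, ?_, ?_⟩
  · rintro rfl ⟨m, hm⟩
    obtain ⟨σ, hσ⟩ := hstable.exists_perm_adj
    obtain ⟨I, hI⟩ := G.exists_isNIndepSet_indepNum
    exact SimpleGraph.exists_isPerfectMatching hσ hI.isIndepSet (by rw [hI.card_eq]; omega)
  · rintro rfl ⟨m, hm⟩
    obtain ⟨σ, hσ⟩ := hstable.exists_perm_adj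
    obtain ⟨I, hI⟩ := G.exists_isNIndepSet_indepNum
    obtain ⟨C, M, hC, hM, hCM, hs⟩ :=
      SimpleGraph.exists_odd_cycle_sup_matching hσ hI.isIndepSet (by rw [hI.card_eq]; omega)
    exact ⟨C ⊔ M, hs, C, M, hC, hM, hCM, rfl⟩
  · rintro rfl ⟨m, hm⟩
    -- a single vertex would have independence number `0`
    have hne : m ≠ 0 := by
      rintro rfl
      have : Nonempty V := Fintype.card_pos_iff.1 (by omega)
      have h1 := SimpleGraph.IsIndepSet.card_le_indepNum (G := G)
        (t := {Classical.arbitrary V}) (by simp)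
      rw [Finset.card_singleton] at h1
      omega
    exact (hstable.isPairAvoiding (by omega)).nonempty_iso_cycleGraph (by omega)
  · rintro rfl ⟨m, hm⟩
    have hcard : Fintype.card V = 2 * G.indepNum + 2 := by omega
    have h := hstable.isPairAvoiding (by omega)
    rcases h.hasOddSplit_or_exists_isEvenSubdivision hcard with hs | ⟨K, hK, hs⟩
    · obtain ⟨C₁, C₂, h₁, h₂, hd, hsp⟩ := h.exists_two_odd_cycles hcard hs
      exact ⟨C₁ ⊔ C₂, hsp, Or.inl ⟨C₁, C₂, h₁, h₂, hd, rfl⟩⟩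
    · refine ⟨SimpleGraph.toSubgraph K hK, SimpleGraph.toSubgraph.isSpanning K hK, Or.inr ?_⟩
      exact hs.of_iso_right ((SimpleGraph.Subgraph.spanningCoeEquivCoeOfSpanning _
        (SimpleGraph.toSubgraph.isSpanning K hK)).symm)
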